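/- Let $S$ be an integral domain which is not a field, let $F$ be its field of fractions, and let $A$ be a commutative (unital) $F$-algebra such that the structure map $F\to A$ is not surjective (in particular $A\ne 0$, so that $S\subseteq F\subsetneq A$ after identifying $F$ and $S$ with their images in $A$). A basis $B$ of $A$ over $F$ is called $S$-stable if there is a basis $C$ of $A$ over $F$ such that $cb\in\sum_{y\in B}Sy$ for all $c\in C$ and $b\in B$. An $S$-subalgebra $R$ of $A$ is called $S$-nice if $R\cap F=S$ and $RF=A$, where $RF$ denotes the $F$-linear span of $R$. Let $\mathcal C$ be a chain (a set totally ordered by inclusion) of prime ideals of $S$. A chain $\mathcal D$ of prime ideals of an $S$-subalgebra $R$ of $A$ is said to cover $\mathcal C$ if for every $P\in\mathcal C$ there exists $Q\in\mathcal D$ with $Q\cap S=P$. Assume that there exists an $S$-stable basis of $A$ over $F$. Then for every chain $\mathcal C$ of prime ideals of $S$ there exists an $S$-nice subalgebra $R$ of $A$ that has a chain of prime ideals covering $\mathcal C$. In fact, there exists an infinite strictly descending chain $R_0\supsetneq R_1\supsetneq R_2\supsetneq\cdots$ of $S$-nice subalgebras of $A$, each of which has a chain of prime ideals covering $\mathcal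 C$. -/

import Mathlib

/-- A subset `B` of an `F`-vector space `A` that is a basis of `A` over `F`. -/
structure IsBasisSet (F : Type*) {A : Type*} [Field F] [AddCommGroup A] [Module F A]
    (B : Set A) : Prop where
  linearIndep : LinearIndepOn F id B
  span_eq_top : Submodule.span F B = ⊤

/-- The basis `C` of `A` over `F` stabilizes `B`: one has `c * b ∈ ∑_{y ∈ B} S y` for all
`c ∈ C` and `b ∈ B`. -/
structure Stabilizes (S F : Type*) {A : Type*} [CommRing S] [Field F] [Ring A]
    [Algebra S A] [Algebra F A] (C B : Set A) : Prop where
  isBasisSet : IsBasisSet F C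
  mul_mem : ∀ c ∈ C, ∀ b ∈ B, c * b ∈ Submodule.span S B

/-- `B` is an `S`-stable basis of `A` over `F`. -/
structure IsStableBasis (S F : Type*) {A : Type*} [CommRing S] [Field F] [Ring A]
    [Algebra S A] [Algebra F A] (B : Set A) : Prop where
  isBasisSet : IsBasisSet F B
  exists_stabilizes : ∃ C : Set A, Stabilizes S F C B

/-- `R` is an `S`-nice subalgebra of `A`: `R ∩ F = S` and `R F = A`, where `S` and `F` are
identified with their images in `A`. -/
structure IsNice {S : Type*} (F : Type*) {A : Type*} [CommRing S] [Field F] [Ring A]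
    [Algebra S A] [Algebra F A] (R : Subalgebra S A) : Prop where
  inter_eq : (R : Set A) ∩ Set.range (algebraMap F A) = Set.range (algebraMap S A)
  span_eq_top : Submodule.span F (R : Set A) = ⊤

/-- A set `D` of prime ideals of the `S`-algebra `R` covers a set `C` of prime ideals of `S`:
every `P ∈ C` is of the form `Q ∩ S` for some `Q ∈ D`. -/
def Covers {S R : Type*} [CommRing S] [CommRing R] [Algebra S R]
    (D : Set (PrimeSpectrum R)) (C : Set (PrimeSpectrum S)) : Prop :=
  ∀ P ∈ C, ∃ Q ∈ D, Q.asIdeal.LiesOver P.asIdeal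

/-- The `S`-algebra `R` has a chain of prime ideals covering `C`. -/
def HasCoveringChain {S : Type*} (R : Type*) [CommRing S] [CommRing R] [Algebra S R]
    (C : Set (PrimeSpectrum S)) : Prop :=
  ∃ D : Set (PrimeSpectrum R), IsChain (· ≤ ·) D ∧ Covers D C

/-!
Let `M` be the `S`-lattice spanned by a stable basis and let `R` be a subalgebra of `A` with
`R M ⊆ M`. A finite chain `P₁ ≤ ⋯ ≤ Pₙ` lifts to `R` provided `0` is avoided by the multiplicative
set obtained from `1` by adjoining, for `i = n, …, 1`, the elements of `S \ Pᵢ` and then everything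
congruent modulo `Pᵢ R`. To see this, choose `v ∈ M` outside `Pₙ M`. Since `M / Pᵢ M` is
torsion-free over `S / Pᵢ` and `Pᵢ M ⊆ Pᵢ₊₁ M`, no element of the `i`-th set moves `v` into `Pᵢ M`.
Only faithful flatness of `M` is needed here. Infinite chains follow because the prime spectrum of
`R` is compact in the constructible topology.

The multiplier ring `R₀ = {a | a M ⊆ M}` is nice, and so are the rings `S + sⁿ R₀`. They decrease
strictly for a suitable `s`: multiplying by an element of `M ∩ S` embeds `R₀` in the lattice `M`, so
some functional `φ : R₀ → S` has `φ 1 = 0` and `φ x ≠ 0` for some `x`. With `t` a nonzero nonunit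
and `s = φ x * t`, the value `φ x` does not lie in `s S ⊇ φ (S + s R₀)`.
-/

section Compactness

variable {S R : Type*} [CommRing S] [CommRing R] [Algebra S R]

theorem isClopen_setOf_mem_asIdeal (r : R) :
    IsClopen {Q : WithConstructibleTopology (PrimeSpectrum R) | r ∈ Q.ofTopology.asIdeal} := by
  have hcompl : {Q : PrimeSpectrum R | r ∈ Q.asIdeal}ᶜ = PrimeSpectrum.basicOpen r := rfl
  have hopen := PrimeSpectrum.isOpen_basicOpen (a := r)
  have hcompact := PrimeSpectrum.isCompact_basicOpen r
  constructor
  · rw [← isOpen_compl_iff]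
    exact hcompact.isOpen_constructibleTopology_of_isOpen hopen
  · exact IsCompact.isOpen_constructibleTopology_of_isClosed (hcompl ▸ hcompact)
      ⟨hcompl ▸ hopen⟩

variable {Y : Type*} [TopologicalSpace Y] {f g : Y → WithConstructibleTopology (PrimeSpectrum R)}

theorem isClosed_setOf_asIdeal_le (hf : Continuous f) (hg : Continuous g) :
    IsClosed {y | (f y).ofTopology.asIdeal ≤ (g y).ofTopology.asIdeal} := by
  simp only [SetLike.le_def, Set.ofPred_forall]
  exact isClosed_iInter fun r ↦ isClosed_imp
    ((isClopen_setOf_mem_asIdeal r).isOpen.preimage hf)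
    ((isClopen_setOf_mem_asIdeal r).isClosed.preimage hg)

theorem isClosed_setOf_liesOver (hf : Continuous f) (P : Ideal S) :
    IsClosed {y | (f y).ofTopology.asIdeal.LiesOver P} := by
  simp only [Ideal.liesOver_iff, Ideal.ext_iff, Ideal.mem_under, Set.ofPred_forall]
  refine isClosed_iInter fun s ↦ ?_
  have hs := (isClopen_setOf_mem_asIdeal (algebraMap S R s)).preimage hf
  by_cases hsP : s ∈ P
  · simp only [hsP, true_iff]
    exact hs.isClosed
  · simp only [hsP, false_iff]
    exact hs.compl.isClosed

theorem HasCoveringChain.of_forall_finset {C : Set (PrimeSpectrum S)}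
    (h : ∀ s : Finset C, HasCoveringChain R (Subtype.val '' (s : Set C))) :
    HasCoveringChain R C := by
  classical
  let lifts (s : Finset C) : Set (C → WithConstructibleTopology (PrimeSpectrum R)) :=
    {q | (∀ P ∈ s, (q P).ofTopology.asIdeal.LiesOver P.1.asIdeal) ∧
      ∀ P ∈ s, ∀ P' ∈ s, (q P).ofTopology.asIdeal ≤ (q P').ofTopology.asIdeal ∨
        (q P').ofTopology.asIdeal ≤ (q P).ofTopology.asIdeal}
  have lifts_anti : Antitone lifts := fun s t hst q hq ↦
    ⟨fun P hP ↦ hq.1 P (hst hP), fun P hP P' hP' ↦ hq.2 P (hst hP) P' (hst hP')⟩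
  have lifts_closed (s : Finset C) : IsClosed (lifts s) := by
    simp only [lifts, Set.ofPred_and, Set.ofPred_forall, Set.ofPred_or]
    refine .inter
      (isClosed_biInter fun P _ ↦ isClosed_setOf_liesOver (continuous_apply P) _)
      (isClosed_biInter fun P _ ↦ isClosed_biInter fun P' _ ↦ .union ?_ ?_)
    all_goals exact isClosed_setOf_asIdeal_le (continuous_apply _) (continuous_apply _)
  have lifts_nonempty (s : Finset C) : (lifts s).Nonempty := by
    obtain ⟨D, hD, hcov⟩ := h s
    have hq (P : C) : ∃ Q : PrimeSpectrum R, P ∈ s → Q ∈ D ∧ Q.asIdeal.LiesOver P.1.asIdeal := by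
      by_cases hP : P ∈ s
      · obtain ⟨Q, hQ⟩ := hcov P ⟨P, hP, rfl⟩
        exact ⟨Q, fun _ ↦ hQ⟩
      · obtain ⟨_, -, hcovP⟩ := h {P}
        obtain ⟨Q, -⟩ := hcovP P (by simp)
        exact ⟨Q, fun hP' ↦ absurd hP' hP⟩
    choose q hq using hq
    exact ⟨fun P ↦ .toTopology _ (q P), fun P hP ↦ (hq P hP).2,
      fun P hP P' hP' ↦ hD.total (hq P hP).1 (hq P' hP').1⟩
  obtain ⟨q, hq⟩ := IsCompact.nonempty_iInter_of_directed_nonempty_isCompact_isClosed lifts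
    (directed_of_isDirected_le lifts_anti) lifts_nonempty
    (fun s ↦ (lifts_closed s).isCompact) lifts_closed
  rw [Set.mem_iInter] at hq
  refine ⟨Set.range fun P ↦ (q P).ofTopology, ?_, fun P hP ↦
    ⟨_, ⟨⟨P, hP⟩, rfl⟩, (hq {⟨P, hP⟩}).1 _ (by simp)⟩⟩
  rintro _ ⟨P, rfl⟩ _ ⟨P', rfl⟩ -
  exact (hq {P, P'}).2 P (by simp) P' (by simp)

end Compactness

section ChainLifting

variable {S R : Type*} [CommRing S] [CommRing R] [Algebra S R]

theorem mem_smul_top_of_smul_mem {M : Type*} [AddCommGroup M] [Module S M] [Module.Flat S M]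
    {P : Ideal S} [P.IsPrime] {u : S} (hu : u ∉ P) {m : M} (h : u • m ∈ P • (⊤ : Submodule S M)) :
    m ∈ P • (⊤ : Submodule S M) := by
  have hreg : IsSMulRegular (S ⧸ P) u := by
    rw [isSMulRegular_iff_right_eq_zero_of_smul]
    intro x hx
    rw [Algebra.smul_def] at hx
    exact (mul_eq_zero.1 hx).resolve_left (by simpa [Ideal.Quotient.eq_zero_iff_mem] using hu)
  exact mem_of_isSMulRegular_quotient_of_smul_mem
    ((TensorProduct.quotTensorEquivQuotSMul M P).isSMulRegular_congr u |>.1 (hreg.rTensor M)) h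

/-- The elements of `R` congruent modulo `P R` to the product of an element of `S \ P` and an
element of `W`. Any ideal avoiding them lies in a prime over `P` that avoids `W`, so iterating this
along a list of primes controls the lifting of the list. -/
def primeExtension (P : PrimeSpectrum S) (W : Submonoid R) : Submonoid R :=
  let π := Ideal.Quotient.mk (P.asIdeal.map (algebraMap S R))
  ((P.asIdeal.primeCompl.map (algebraMap S R) ⊔ W).map π).comap π

theorem mem_primeExtension {P : PrimeSpectrum S} {W : Submonoid R} {z : R} :
    z ∈ primeExtension P W ↔ ∃ u ∉ P.asIdeal, ∃ w ∈ W,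
      z - algebraMap S R u * w ∈ P.asIdeal.map (algebraMap S R) := by
  simp [primeExtension, Submonoid.mem_sup, Submonoid.mem_map, ← Ideal.Quotient.eq, eq_comm,
    and_assoc]

theorem exists_liesOver_disjoint_of_disjoint_primeExtension {P : PrimeSpectrum S}
    {W : Submonoid R} {J : Ideal R} (hJ : Disjoint (J : Set R) (primeExtension P W)) :
    ∃ Q : PrimeSpectrum R, J ≤ Q.asIdeal ∧ Q.asIdeal.LiesOver P.asIdeal ∧
      Disjoint (Q.asIdeal : Set R) W := by
  have hdisj : Disjoint ((J ⊔ P.asIdeal.map (algebraMap S R) : Ideal R) : Set R)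
      (P.asIdeal.primeCompl.map (algebraMap S R) ⊔ W : Submonoid R) := by
    rw [Set.disjoint_left]
    intro z hz hzU
    obtain ⟨_, ⟨u, hu, rfl⟩, w, hw, rfl⟩ := Submonoid.mem_sup.1 hzU
    obtain ⟨y, hy, x, hx, hyx⟩ := Submodule.mem_sup.1 hz
    refine Set.disjoint_left.1 hJ hy (mem_primeExtension.2 ⟨u, hu, w, hw, ?_⟩)
    rw [← hyx, sub_add_cancel_left]
    exact neg_mem hx
  obtain ⟨Q, hQ, hle, hQU⟩ := Ideal.exists_le_prime_disjoint _ _ hdisj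
  refine ⟨⟨Q, hQ⟩, le_sup_left.trans hle, ⟨le_antisymm ?_ fun s hs ↦ ?_⟩,
    hQU.mono_right (SetLike.coe_subset_coe.2 le_sup_right)⟩
  · exact Ideal.map_le_iff_le_comap.1 (le_sup_right.trans hle)
  · by_contra hsP
    exact Set.disjoint_left.1 hQU hs
      (Submonoid.mem_sup_left (Submonoid.mem_map_of_mem (algebraMap S R) hsP))

theorem exists_isChain_covers_of_disjoint_foldr (l : List (PrimeSpectrum S)) {J : Ideal R}
    (hJ : Disjoint (J : Set R) (l.foldr primeExtension ⊥ : Submonoid R)) :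
    ∃ D : Set (PrimeSpectrum R), (∀ Q ∈ D, J ≤ Q.asIdeal) ∧ IsChain (· ≤ ·) D ∧
      Covers D {P | P ∈ l} := by
  induction l generalizing J with
  | nil => exact ⟨∅, by simp, .empty, by simp [Covers]⟩
  | cons P l ih =>
    obtain ⟨Q, hJQ, hQP, hQ⟩ := exists_liesOver_disjoint_of_disjoint_primeExtension hJ
    obtain ⟨D, hQD, hD, hcov⟩ := ih hQ
    refine ⟨insert Q D, ?_, hD.insert fun Q' hQ' _ ↦ .inl (hQD Q' hQ'), fun P' hP' ↦ ?_⟩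
    · exact Set.forall_mem_insert.2 ⟨hJQ, fun Q' hQ' ↦ hJQ.trans (hQD Q' hQ')⟩
    · obtain rfl | hP' := List.mem_cons.1 hP'
      · exact ⟨Q, Set.mem_insert .., hQP⟩
      · obtain ⟨Q', hQ', hover⟩ := hcov P' hP'
        exact ⟨Q', Set.mem_insert_of_mem _ hQ', hover⟩

variable {M : Type*} [AddCommGroup M] [Module S M] [Module R M] [IsScalarTower S R M]

theorem smul_mem_smul_top_of_mem_map {I : Ideal S} {x : R} (hx : x ∈ I.map (algebraMap S R))
    (m : M) : x • m ∈ I • (⊤ : Submodule S M) := by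
  induction hx using Submodule.span_induction generalizing m with
  | mem x hx =>
    obtain ⟨s, hs, rfl⟩ := hx
    rw [algebraMap_smul]
    exact Submodule.smul_mem_smul hs trivial
  | zero => simp
  | add x y _ _ hx hy => rw [add_smul]; exact add_mem (hx m) (hy m)
  | smul r x _ hx => rw [smul_eq_mul, mul_comm, mul_smul]; exact hx _

theorem smul_notMem_smul_top_of_mem_primeExtension [Module.Flat S M] {P : PrimeSpectrum S}
    {W : Submonoid R} {v : M} (hW : ∀ w ∈ W, w • v ∉ P.asIdeal • (⊤ : Submodule S M)) {z : R}
    (hz : z ∈ primeExtension P W) : z • v ∉ P.asIdeal • (⊤ : Submodule S M) := by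
  obtain ⟨u, hu, w, hw, hzuw⟩ := mem_primeExtension.1 hz
  intro hzv
  have huwv : u • w • v ∈ P.asIdeal • (⊤ : Submodule S M) := by
    have := sub_mem hzv (smul_mem_smul_top_of_mem_map hzuw v)
    rwa [sub_smul, sub_sub_cancel, mul_smul, algebraMap_smul] at this
  exact hW w hw (mem_smul_top_of_smul_mem hu huwv)

theorem smul_notMem_smul_top_of_mem_foldr [Module.Flat S M] {l : List (PrimeSpectrum S)}
    (hl : l.Pairwise (· ≤ ·)) {v : M} {P : PrimeSpectrum S}
    (hv : v ∉ P.asIdeal • (⊤ : Submodule S M))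
    (hvl : ∀ P' ∈ l, v ∉ P'.asIdeal • (⊤ : Submodule S M)) (hP : ∀ P' ∈ l, P ≤ P') {w : R}
    (hw : w ∈ l.foldr primeExtension ⊥) : w • v ∉ P.asIdeal • (⊤ : Submodule S M) := by
  induction l generalizing P w with
  | nil =>
    obtain rfl : w = 1 := hw
    rwa [one_smul]
  | cons P' l ih =>
    simp only [List.pairwise_cons, List.forall_mem_cons] at hl hvl hP
    have hwP' := smul_notMem_smul_top_of_mem_primeExtension
      (fun w ↦ ih hl.2 hvl.1 hvl.2 hl.1) hw
    exact fun h ↦ hwP' (Submodule.smul_mono_left hP.1 h)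

theorem hasCoveringChain_of_pairwise_le [Module.Flat S M] {l : List (PrimeSpectrum S)}
    (hl : l.Pairwise (· ≤ ·)) {v : M} (hv : ∀ P ∈ l, v ∉ P.asIdeal • (⊤ : Submodule S M)) :
    HasCoveringChain R {P | P ∈ l} := by
  cases l with
  | nil => exact ⟨∅, .empty, by simp [Covers]⟩
  | cons P l =>
    have hdisj : Disjoint ((⊥ : Ideal R) : Set R)
        ((P :: l).foldr primeExtension ⊥ : Submonoid R) := by
      rw [Set.disjoint_left]
      rintro _ rfl h0
      have hP : ∀ P' ∈ P :: l, P ≤ P' :=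
        List.forall_mem_cons.2 ⟨le_rfl, fun _ ↦ List.rel_of_pairwise_cons hl⟩
      refine smul_notMem_smul_top_of_mem_foldr hl (hv P List.mem_cons_self) hv hP h0 ?_
      rw [zero_smul]
      exact zero_mem _
    obtain ⟨D, -, hD, hcov⟩ := exists_isChain_covers_of_disjoint_foldr _ hdisj
    exact ⟨D, hD, hcov⟩

theorem hasCoveringChain_of_faithfullyFlat (M : Type*) [AddCommGroup M] [Module S M] [Module R M]
    [IsScalarTower S R M] [Module.FaithfullyFlat S M] {C : Set (PrimeSpectrum S)}
    (hC : IsChain (· ≤ ·) C) : HasCoveringChain R C := by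
  classical
  refine HasCoveringChain.of_forall_finset fun s ↦ ?_
  let _ : LinearOrder C := hC.linearOrder
  have hsort : ((s.sort (· ≤ ·)).map Subtype.val).Pairwise (· ≤ ·) :=
    List.pairwise_map.2 (s.pairwise_sort (· ≤ ·))
  obtain ⟨v, hv⟩ : ∃ v : M, ∀ P ∈ s, v ∉ P.1.asIdeal • (⊤ : Submodule S M) := by
    obtain rfl | hs := s.eq_empty_or_nonempty
    · exact ⟨0, by simp⟩
    have hne := ((Module.FaithfullyFlat.iff_flat_and_proper_ideal S M).1 inferInstance).2 _
      (s.max' hs).1.2.ne_top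
    obtain ⟨v, -, hv⟩ := SetLike.exists_of_lt hne.lt_top
    exact ⟨v, fun P hP h ↦ hv (Submodule.smul_mono_left (s.le_max' P hP) h)⟩
  have himage : Subtype.val '' (s : Set C) = {P | P ∈ (s.sort (· ≤ ·)).map Subtype.val} := by
    ext
    simp
  rw [himage]
  exact hasCoveringChain_of_pairwise_le hsort (v := v) (by simpa using! hv)

end ChainLifting

section Multiplier

variable {S A : Type*} [CommRing S] [CommRing A] [Algebra S A]

/-- The ring `{a | a M ⊆ M}` of multipliers of `M`: the largest subalgebra of `A` over which `M`
is a module. -/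
def multiplierSubalgebra (M : Submodule S A) : Subalgebra S A :=
  (M / M).toSubalgebra (Submodule.one_mem_div.2 le_rfl) fun a b ha hb ↦
    Submodule.mem_div_iff_forall_mul_mem.2 fun m hm ↦ by
      rw [mul_assoc]
      exact ha _ (hb m hm)

theorem mem_multiplierSubalgebra {M : Submodule S A} {a : A} :
    a ∈ multiplierSubalgebra M ↔ ∀ m ∈ M, a * m ∈ M :=
  Submodule.mem_div_iff_forall_mul_mem

theorem mem_multiplierSubalgebra_span {B : Set A} {a : A} :
    a ∈ multiplierSubalgebra (Submodule.span S B) ↔ ∀ b ∈ B, a * b ∈ Submodule.span S B :=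
  mem_multiplierSubalgebra.trans
    (Submodule.span_le (p := (Submodule.span S B).comap (LinearMap.mulLeft S a)))

theorem hasCoveringChain_of_le_multiplierSubalgebra {M : Submodule S A}
    [hM : Module.FaithfullyFlat S M] {R : Subalgebra S A} (hR : R ≤ multiplierSubalgebra M)
    {C : Set (PrimeSpectrum S)} (hC : IsChain (· ≤ ·) C) : HasCoveringChain R C := by
  let N : Submodule R A :=
    { M with smul_mem' := fun r _ hm ↦ mem_multiplierSubalgebra.1 (hR r.2) _ hm }
  have : Module.FaithfullyFlat S N := hM
  exact hasCoveringChain_of_faithfullyFlat N hC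

variable {F : Type*} [Field F] [Algebra F A]

theorem Stabilizes.span_multiplierSubalgebra_eq_top {B K : Set A} (h : Stabilizes S F K B) :
    Submodule.span F (multiplierSubalgebra (Submodule.span S B) : Set A) = ⊤ := by
  rw [eq_top_iff, ← h.isBasisSet.span_eq_top]
  exact Submodule.span_mono fun c hc ↦ mem_multiplierSubalgebra_span.2 (h.mul_mem c hc)

variable [Algebra S F] [IsScalarTower S F A]

theorem isNice_iff {R : Subalgebra S A} :
    IsNice F R ↔ (∀ f : F, algebraMap F A f ∈ R → algebraMap F A f ∈ Set.range (algebraMap S A)) ∧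
      Submodule.span F (R : Set A) = ⊤ := by
  refine ⟨fun h ↦ ⟨fun f hf ↦ h.inter_eq.le ⟨hf, f, rfl⟩, h.span_eq_top⟩,
    fun h ↦ ⟨Set.Subset.antisymm ?_ ?_, h.2⟩⟩
  · rintro _ ⟨hf, f, rfl⟩
    exact h.1 f hf
  · rintro _ ⟨s, rfl⟩
    exact ⟨R.algebraMap_mem s, algebraMap S F s, (IsScalarTower.algebraMap_apply S F A s).symm⟩

theorem isNice_multiplierSubalgebra [IsFractionRing S F] {M : Submodule S A} [Module.Free S M]
    [Nontrivial M] (hspan : Submodule.span F (multiplierSubalgebra M : Set A) = ⊤) :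
    IsNice F (multiplierSubalgebra M) := by
  refine isNice_iff.2 ⟨fun f hf ↦ ?_, hspan⟩
  have : Nontrivial S := Module.nontrivial S M
  have e := Module.Free.chooseBasis S M
  obtain ⟨i⟩ := e.index_nonempty
  obtain ⟨s, t, ht, rfl⟩ := IsFractionRing.div_surjective (A := S) f
  have ht0 : algebraMap S F t ≠ 0 := by simpa using nonZeroDivisors.ne_zero ht
  let m : M := ⟨_, mem_multiplierSubalgebra.1 hf (e i) (e i).2⟩
  have htm : t • m = s • e i := by
    refine Subtype.ext ?_
    change t • (algebraMap F A _ * _) = s • (e i : A)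
    rw [← Algebra.smul_def, ← algebraMap_smul F t, smul_smul, mul_div_cancel₀ _ ht0,
      algebraMap_smul]
  have hst : s = t * e.repr m i := by simpa using congr(e.repr $htm.symm i)
  refine ⟨e.repr m i, ?_⟩
  rw [IsScalarTower.algebraMap_apply S F A, hst, map_mul, mul_div_cancel_left₀ _ ht0]

end Multiplier

section Dual

variable {S M : Type*} [CommRing S] [AddCommGroup M] [Module S M]

theorem exists_dual_eq_zero_and_ne_zero_of_linearIndependent [Nontrivial S] [Module.Projective S M]
    {m n : M} (h : LinearIndependent S ![m, n]) : ∃ φ : Module.Dual S M, φ m = 0 ∧ φ n ≠ 0 := by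
  obtain ⟨ψ, hψ⟩ := Module.Projective.exists_dual_ne_zero S (h.ne_zero 0)
  by_contra! hφ
  have hmn : ψ m • n - ψ n • m = 0 := by
    refine (Module.forall_dual_apply_eq_zero_iff S _).1 fun χ ↦ ?_
    have := hφ (ψ m • χ - χ m • ψ) (by simp [mul_comm])
    simpa [mul_comm] using this
  rw [LinearIndependent.pair_iff] at h
  exact hψ (h (-ψ n) (ψ m) (by rw [← hmn]; module)).2

end Dual

section Conductor

variable {S A : Type*} [CommRing S] [CommRing A] [Algebra S A]

/-- The subalgebra `S + s R` of `R`, whose conductor in `R` contains `s`. Taken along the powers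
of `s`, these form the descending chain of nice subalgebras. -/
def conductorSubalgebra (R : Subalgebra S A) (s : S) : Subalgebra S A where
  carrier := {x | ∃ c : S, ∃ r ∈ R, x = algebraMap S A c + s • r}
  mul_mem' := by
    rintro _ _ ⟨c, r, hr, rfl⟩ ⟨c', r', hr', rfl⟩
    refine ⟨c * c', c • r' + c' • r + s • (r * r'), R.add_mem (R.add_mem (R.smul_mem hr' c)
      (R.smul_mem hr c')) (R.smul_mem (R.mul_mem hr hr') s), ?_⟩
    simp only [Algebra.smul_def, map_mul]
    ring
  add_mem' := by
    rintro _ _ ⟨c, r, hr, rfl⟩ ⟨c', r', hr', rfl⟩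
    refine ⟨c + c', r + r', R.add_mem hr hr', ?_⟩
    rw [map_add, smul_add]
    abel
  algebraMap_mem' c := ⟨c, 0, R.zero_mem, by simp⟩

theorem smul_mem_conductorSubalgebra {R : Subalgebra S A} {x : A} (hx : x ∈ R) (s : S) :
    s • x ∈ conductorSubalgebra R s :=
  ⟨0, x, hx, by simp⟩

theorem conductorSubalgebra_le (R : Subalgebra S A) (s : S) : conductorSubalgebra R s ≤ R := by
  rintro _ ⟨c, r, hr, rfl⟩
  exact R.add_mem (R.algebraMap_mem c) (R.smul_mem hr s)

theorem conductorSubalgebra_le_of_dvd (R : Subalgebra S A) {s t : S} (h : s ∣ t) :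
    conductorSubalgebra R t ≤ conductorSubalgebra R s := by
  obtain ⟨u, rfl⟩ := h
  rintro _ ⟨c, r, hr, rfl⟩
  exact ⟨c, u • r, R.smul_mem hr u, by rw [mul_smul]⟩

theorem notMem_conductorSubalgebra_of_dual [IsDomain S] {R : Subalgebra S A}
    {φ : Module.Dual S R} (hφ : φ 1 = 0) {x : R} (hx : φ x ≠ 0) {t : S} (ht : ¬ IsUnit t) :
    (x : A) ∉ conductorSubalgebra R (φ x * t) := by
  rintro ⟨c, r, hr, hxr⟩
  have hxr : x = c • (1 : R) + (φ x * t) • ⟨r, hr⟩ :=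
    Subtype.ext (by simpa [Algebra.algebraMap_eq_smul_one] using hxr)
  have hφx : φ x * (t * φ ⟨r, hr⟩) = φ x * 1 := by
    have := congr(φ $hxr)
    rwa [map_add, map_smul, map_smul, hφ, smul_zero, zero_add, smul_eq_mul, mul_assoc, eq_comm,
      ← mul_one (φ x), mul_assoc, one_mul] at this
  exact ht (.of_mul_eq_one _ (mul_left_cancel₀ hx hφx))

variable {F : Type*} [Field F] [Algebra F A] {R : Subalgebra S A}

theorem IsNice.exists_notMem_range (hR : IsNice F R)
    (hA : ¬ Function.Surjective (algebraMap F A)) : ∃ x ∈ R, x ∉ Set.range (algebraMap F A) := by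
  by_contra! h
  have hle : Submodule.span F (R : Set A) ≤ LinearMap.range (Algebra.linearMap F A) :=
    Submodule.span_le.2 h
  rw [hR.span_eq_top] at hle
  exact hA fun a ↦ hle Submodule.mem_top

variable [Algebra S F] [FaithfulSMul S F] [IsScalarTower S F A]

theorem isNice_conductorSubalgebra (hR : IsNice F R) {s : S} (hs : s ≠ 0) :
    IsNice F (conductorSubalgebra R s) := by
  refine isNice_iff.2 ⟨fun f hf ↦ (isNice_iff.1 hR).1 f (conductorSubalgebra_le R s hf), ?_⟩
  rw [eq_top_iff, ← hR.span_eq_top, Submodule.span_le]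
  intro r hr
  have hs' : algebraMap S F s ≠ 0 := by simpa using hs
  have hsr := Submodule.smul_mem _ (algebraMap S F s)⁻¹
    (Submodule.subset_span (R := F) (smul_mem_conductorSubalgebra hr s))
  rwa [← algebraMap_smul F s r, inv_smul_smul₀ hs'] at hsr

theorem IsNice.mem_conductorSubalgebra_of_smul_mem (hR : IsNice F R) {t : S} (ht : t ≠ 0) {s : S}
    {x : A} (hx : x ∈ R) (h : t • x ∈ conductorSubalgebra R (t * s)) :
    x ∈ conductorSubalgebra R s := by
  obtain ⟨c, r, hr, htx⟩ := h
  have ht' : algebraMap S F t ≠ 0 := by simpa using ht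
  have hc : x - s • r = algebraMap F A (algebraMap S F c / algebraMap S F t) := by
    rw [sub_eq_iff_eq_add]
    refine smul_right_injective A ht' ?_
    simp only [smul_add, algebraMap_smul, htx, smul_smul]
    rw [← algebraMap_smul F t, Algebra.smul_def (algebraMap S F t), ← map_mul,
      mul_div_cancel₀ _ ht', ← IsScalarTower.algebraMap_apply]
  have hmem : x - s • r ∈ R := sub_mem hx (R.smul_mem hr s)
  obtain ⟨c', hc'⟩ := (isNice_iff.1 hR).1 _ (hc ▸ hmem)
  exact ⟨c', r, hr, by rw [hc', ← hc, sub_add_cancel]⟩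

theorem IsNice.strictAnti_conductorSubalgebra_pow (hR : IsNice F R) {s : S}
    (hs : s ≠ 0) {x : A} (hx : x ∈ R) (hxs : x ∉ conductorSubalgebra R s) :
    StrictAnti fun n : ℕ ↦ conductorSubalgebra R (s ^ n) := by
  have : IsDomain S := (FaithfulSMul.algebraMap_injective S F).isDomain
  refine strictAnti_nat_of_succ_lt fun n ↦ lt_of_le_not_ge
    (conductorSubalgebra_le_of_dvd R (pow_dvd_pow s n.le_succ)) fun hle ↦ hxs ?_
  have := hle (smul_mem_conductorSubalgebra hx (s ^ n))
  rw [pow_succ] at this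
  exact hR.mem_conductorSubalgebra_of_smul_mem (pow_ne_zero n hs) hx this

end Conductor

section BasisSet

variable {S F V : Type*} [CommRing S] [Field F] [Algebra S F] [AddCommGroup V] [Module F V]
  [Module S V] [IsScalarTower S F V] {B : Set V}

theorem IsBasisSet.free_span [FaithfulSMul S F] (hB : IsBasisSet F B) :
    Module.Free S (Submodule.span S B) := by
  have hli : LinearIndependent S ((↑) : B → V) :=
    LinearIndependent.restrict_scalars' S hB.linearIndep
  have := Module.Free.of_basis (Module.Basis.span hli)
  rwa [Subtype.range_coe] at this

theorem IsBasisSet.span_span_eq_top (hB : IsBasisSet F B) :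
    Submodule.span F (Submodule.span S B : Set V) = ⊤ := by
  rw [Submodule.span_span_of_tower, hB.span_eq_top]

theorem IsBasisSet.nontrivial_span [Nontrivial V] (hB : IsBasisSet F B) :
    Nontrivial (Submodule.span S B) := by
  rw [Submodule.nontrivial_iff_ne_bot]
  intro h
  have := hB.span_span_eq_top (S := S)
  simp [h] at this

end BasisSet

section MultiplierDual

variable {S F A : Type*} [CommRing S] [Field F] [Algebra S F] [CommRing A] [Algebra F A]
  [Algebra S A] [IsScalarTower S F A]

theorem exists_dual_multiplierSubalgebra [IsFractionRing S F] {M : Submodule S A}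
    [Module.Projective S M] (hM : Submodule.span F (M : Set A) = ⊤) {x : multiplierSubalgebra M}
    (hx : (x : A) ∉ Set.range (algebraMap F A)) :
    ∃ φ : Module.Dual S (multiplierSubalgebra M), φ 1 = 0 ∧ φ x ≠ 0 := by
  have : IsDomain S := (IsFractionRing.injective S F).isDomain
  have : Nontrivial A := not_subsingleton_iff_nontrivial.1 fun _ ↦
    hx (Function.surjective_to_subsingleton _ _)
  have hli : LinearIndependent F ![1, (x : A)] := by
    refine (LinearIndependent.pair_iff' one_ne_zero).2 fun f hf ↦ hx ⟨f, ?_⟩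
    rw [Algebra.algebraMap_eq_smul_one, hf]
  obtain ⟨⟨s, hs⟩, hsM⟩ := multiple_mem_span_of_mem_localization_span (nonZeroDivisors S) F
    (M : Set A) 1 (hM ▸ Submodule.mem_top)
  rw [Submodule.span_eq] at hsM
  let ι : multiplierSubalgebra M →ₗ[S] M :=
    ((LinearMap.mulRight S (s • (1 : A))).domRestrict
      (Subalgebra.toSubmodule (multiplierSubalgebra M))).codRestrict M fun r ↦
      mem_multiplierSubalgebra.1 r.2 _ hsM
  have hι_apply (r) : (ι r : A) = s • (r : A) :=
    (mul_smul_comm s (r : A) 1).trans (by rw [mul_one])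
  have hι : LinearIndependent S ![ι 1, ι x] := by
    refine LinearIndependent.pair_iff.2 fun a b hab ↦ ?_
    have hab : (a * s) • (1 : A) + (b * s) • (x : A) = 0 := by
      simpa [hι_apply, mul_smul] using congr(($hab : A))
    have hs0 := nonZeroDivisors.ne_zero hs
    simpa [hs0] using LinearIndependent.pair_iff.1 (hli.restrict_scalars' S) _ _ hab
  obtain ⟨ψ, hψ⟩ := exists_dual_eq_zero_and_ne_zero_of_linearIndependent hι
  exact ⟨ψ ∘ₗ ι, hψ⟩

end MultiplierDual

theorem mainTheorem5 {S F A : Type*} [CommRing S] [IsDomain S] (hS : ¬ IsField S)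
    [Field F] [Algebra S F] [IsFractionRing S F]
    [CommRing A] [Algebra F A] [Algebra S A] [IsScalarTower S F A]
    (hA : ¬ Function.Surjective (algebraMap F A))
    (hB : ∃ B : Set A, IsStableBasis S F B)
    (C : Set (PrimeSpectrum S)) (hC : IsChain (· ≤ ·) C) :
    (∃ R : Subalgebra S A, IsNice F R ∧ HasCoveringChain R C) ∧
    ∃ R : ℕ → Subalgebra S A, StrictAnti R ∧
      ∀ n, IsNice F (R n) ∧ HasCoveringChain (R n) C := by
  obtain ⟨B, hB, K, hK⟩ := hB
  have : Nontrivial A := not_subsingleton_iff_nontrivial.1 fun _ ↦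
    hA (Function.surjective_to_subsingleton _)
  have := hB.free_span (S := S)
  have := hB.nontrivial_span (S := S)
  have hnice := isNice_multiplierSubalgebra hK.span_multiplierSubalgebra_eq_top
  obtain ⟨x, hx, hxF⟩ := hnice.exists_notMem_range hA
  lift x to multiplierSubalgebra (Submodule.span S B) using hx
  obtain ⟨φ, hφ, hφx⟩ := exists_dual_multiplierSubalgebra hB.span_span_eq_top hxF
  obtain ⟨t, ht, htu⟩ := Ring.exists_not_isUnit_of_not_isField hS
  have hs := mul_ne_zero hφx ht
  have hR (n) := isNice_conductorSubalgebra hnice (pow_ne_zero n hs)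
  have hcov {R} (hR : R ≤ multiplierSubalgebra (Submodule.span S B)) : HasCoveringChain R C :=
    hasCoveringChain_of_le_multiplierSubalgebra hR hC
  exact ⟨⟨_, hnice, hcov le_rfl⟩, fun n ↦ conductorSubalgebra _ ((φ x * t) ^ n),
    hnice.strictAnti_conductorSubalgebra_pow hs x.2 (notMem_conductorSubalgebra_of_dual hφ hφx htu),
    fun n ↦ ⟨hR n, hcov (conductorSubalgebra_le _ _)⟩⟩
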